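/- Let $\mathbf{S}^n$ be the space of real symmetric $n\times n$ matrices with inner product $\langle X,Y\rangle=\operatorname{tr}(XY)$ (and the Frobenius norm), let $\lambda\colon\mathbf{S}^n\to\mathbb{R}^n$ assign to $X$ the vector of its eigenvalues, with multiplicity, in nonincreasing order, and for $X\in\mathbf{S}^n$ let $$\mathcal{O}_X=\{U \text{ orthogonal } : U(\operatorname{Diag}\lambda(X))U^T=X\}.$$ For a function $g\colon E\to[-\infty,+\infty]$ on a Euclidean space and a point $x$ with $g(x)$ finite, define: - the proximal subdifferential $\partial_p g(x)$: all $v\in E$ for which there are $r,\varepsilon>0$ with $g(y)\ge g(x)+\langle v,y-x\rangle-\frac r2|y-x|^2$ whenever $|y-x|\le\varepsilon$; - the Fréchet subdifferential $\hat\partial g(x)$: all $v\in E$ with $g(y)\ge g(x)+\langle v,y-x\rangle+o(|y-x|)$ as $y\to x$; - the limiting subdifferential $\partial g(x)$: all $v\in E$ for which there are sequences $x_i$ and $v_i\in\hat\partial g(x_i)$ with $(x_i,g(x_i),v_i)\to(x,g(x),v)$; - the horizon subdifferential $\partial^\infty g(x)$: all limits of $t_iv_i$, where $v_i\in\partial g(x_i)$,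 $x_i\to x$, $t_i\ge 0$ and $t_i\searrow 0$. All these sets are taken to be empty at points where $g$ is not finite. **Theorem.** Let $f\colon\mathbb{R}^n\to[-\infty,+\infty]$ be lower semicontinuous and symmetric (invariant under permutations of coordinates). Then for every $X\in\mathbf{S}^n$ $$\partial(f\circ\lambda)(X)=\{U(\operatorname{Diag}v)U^T : v\in\partial f(\lambda(X)),\ U\in\mathcal{O}_X\},$$ and the same formula holds with $\partial$ replaced on both sides by $\partial_p$, by $\hat\partial$, or by $\partial^\infty$. It also holds for the variant of $\partial^\infty$ in which the sequence $x_i$ is required in addition to satisfy $g(x_i)\to g(x)$. -/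

import Mathlib

open Filter Topology

/-! ### Subdifferentials of extended-real-valued functions on a Euclidean space -/

section Subdifferentials

variable {E : Type*} [NormedAddCommGroup E] [InnerProductSpace ℝ E]

/-- The proximal subdifferential: there are `r, ε > 0` with
`f y ≥ f x + ⟪v, y - x⟫ - (r / 2) ‖y - x‖²` on the closed `ε`-ball around `x`.
It is empty at points where `f` is not finite. -/
def proximalSubdifferential (f : E → EReal) (x : E) : Set E :=
  {v | f x ≠ ⊤ ∧ f x ≠ ⊥ ∧ ∃ r : ℝ, 0 < r ∧ ∃ ε : ℝ, 0 < ε ∧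
    ∀ y ∈ Metric.closedBall x ε,
      f x + ((inner ℝ v (y - x) - r / 2 * ‖y - x‖ ^ 2 : ℝ) : EReal) ≤ f y}

/-- The Fréchet subdifferential: `f y ≥ f x + ⟪v, y - x⟫ + o(‖y - x‖)` as `y → x`, where the
little-o bound is written out with an `ε`.  It is empty at points where `f` is not finite. -/
def frechetSubdifferential (f : E → EReal) (x : E) : Set E :=
  {v | f x ≠ ⊤ ∧ f x ≠ ⊥ ∧ ∀ ε : ℝ, 0 < ε → ∀ᶠ y in 𝓝 x,
    f x + ((inner ℝ v (y - x) - ε * ‖y - x‖ : ℝ) : EReal) ≤ f y}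

/-- The limiting subdifferential: limits of Fréchet subgradients `vᵢ` at points `xᵢ → x` with
`f xᵢ → f x`.  It is empty at points where `f` is not finite. -/
def limitingSubdifferential (f : E → EReal) (x : E) : Set E :=
  {v | f x ≠ ⊤ ∧ f x ≠ ⊥ ∧ ∃ (xs : ℕ → E) (vs : ℕ → E),
    (∀ i, vs i ∈ frechetSubdifferential f (xs i)) ∧
    Tendsto xs atTop (𝓝 x) ∧
    Tendsto (fun i => f (xs i)) atTop (𝓝 (f x)) ∧
    Tendsto vs atTop (𝓝 v)}

/-- The horizon subdifferential: limits of `tᵢ vᵢ` with `vᵢ` a limiting subgradient at `xᵢ`,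
`xᵢ → x`, and `tᵢ ≥ 0` decreasing to `0`.  It is empty at points where `f` is not finite. -/
def horizonSubdifferential (f : E → EReal) (x : E) : Set E :=
  {v | f x ≠ ⊤ ∧ f x ≠ ⊥ ∧ ∃ (xs : ℕ → E) (vs : ℕ → E) (t : ℕ → ℝ),
    (∀ i, vs i ∈ limitingSubdifferential f (xs i)) ∧
    Tendsto xs atTop (𝓝 x) ∧
    (∀ i, 0 ≤ t i) ∧ Antitone t ∧ Tendsto t atTop (𝓝 0) ∧
    Tendsto (fun i => t i • vs i) atTop (𝓝 v)}

/-- The `f`-attentive variant of the horizon subdifferential, in which moreover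
`f xᵢ → f x` is required. -/
def attentiveHorizonSubdifferential (f : E → EReal) (x : E) : Set E :=
  {v | f x ≠ ⊤ ∧ f x ≠ ⊥ ∧ ∃ (xs : ℕ → E) (vs : ℕ → E) (t : ℕ → ℝ),
    (∀ i, vs i ∈ limitingSubdifferential f (xs i)) ∧
    Tendsto xs atTop (𝓝 x) ∧
    Tendsto (fun i => f (xs i)) atTop (𝓝 (f x)) ∧
    (∀ i, 0 ≤ t i) ∧ Antitone t ∧ Tendsto t atTop (𝓝 0) ∧
    Tendsto (fun i => t i • vs i) atTop (𝓝 v)}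

end Subdifferentials

/-! ### The Euclidean space of symmetric matrices -/

-- Real matrices carry the Frobenius norm throughout.
attribute [local instance] Matrix.frobeniusNormedAddCommGroup Matrix.frobeniusNormedSpace

/-- The space of real symmetric `n × n` matrices. -/
def SymMat (n : ℕ) : Submodule ℝ (Matrix (Fin n) (Fin n) ℝ) where
  carrier := {A | A.IsSymm}
  add_mem' := fun ha hb => ha.add hb
  zero_mem' := Matrix.isSymm_zero
  smul_mem' := fun c _ ha => ha.smul c

/-- The trace inner product `⟪X, Y⟫ = tr (X Y)`, whose norm is the Frobenius norm. -/
noncomputable instance SymMat.instInnerProductSpace (n : ℕ) :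
    InnerProductSpace ℝ (SymMat n) where
  inner X Y := Matrix.trace ((X : Matrix (Fin n) (Fin n) ℝ) * (Y : Matrix (Fin n) (Fin n) ℝ))
  norm_sq_eq_re_inner X := by
    have hX : ∀ i j, (X : Matrix (Fin n) (Fin n) ℝ) j i = (X : Matrix (Fin n) (Fin n) ℝ) i j :=
      fun i j => X.2.apply i j
    have h0 : 0 ≤ ∑ i, ∑ j, ‖(X : Matrix (Fin n) (Fin n) ℝ) i j‖ ^ (2 : ℝ) := by positivity
    rw [Submodule.coe_norm, Matrix.frobenius_norm_def, ← Real.sqrt_eq_rpow, Real.sq_sqrt h0]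
    simp [Matrix.trace, Matrix.mul_apply, hX, sq]
  conj_inner_symm X Y := by
    exact Matrix.trace_mul_comm (Y : Matrix (Fin n) (Fin n) ℝ) (X : Matrix (Fin n) (Fin n) ℝ)
  add_left X Y Z := by
    simp [Matrix.add_mul]
  smul_left X Y r := by
    simp

/-- A real symmetric matrix is Hermitian. -/
theorem SymMat.isHermitian {n : ℕ} (X : SymMat n) :
    (X : Matrix (Fin n) (Fin n) ℝ).IsHermitian := by
  rw [Matrix.IsHermitian, Matrix.conjTranspose_eq_transpose_of_trivial]
  exact X.2

/-- The eigenvalue map: the eigenvalues of `X`, with multiplicity, in nonincreasing order. -/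
noncomputable def eigenvalueMap {n : ℕ} (X : SymMat n) : EuclideanSpace ℝ (Fin n) :=
  WithLp.toLp 2 fun i => (SymMat.isHermitian X).eigenvalues₀ (Fin.cast (Fintype.card_fin n).symm i)

/-- The set of orthogonal `U` with `U (Diag (λ(X))) Uᵀ = X`. -/
def diagonalizers {n : ℕ} (X : SymMat n) : Set (Matrix (Fin n) (Fin n) ℝ) :=
  {U | U ∈ Matrix.orthogonalGroup (Fin n) ℝ ∧
    U * Matrix.diagonal (fun i => eigenvalueMap X i) * U.transpose
      = (X : Matrix (Fin n) (Fin n) ℝ)}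

/-- For a set `S` of vectors, the set of all `U (Diag v) Uᵀ` with `v ∈ S` and `U ∈ 𝒪_X`. -/
def spectralLift {n : ℕ} (X : SymMat n) (S : Set (EuclideanSpace ℝ (Fin n))) : Set (SymMat n) :=
  {V | ∃ v ∈ S, ∃ U ∈ diagonalizers X,
    (V : Matrix (Fin n) (Fin n) ℝ) = U * Matrix.diagonal (fun i => v i) * U.transpose}

/-- A function on `ℝⁿ` is symmetric if it is invariant under coordinate permutations. -/
def IsSymmetricFun {n : ℕ} (f : EuclideanSpace ℝ (Fin n) → EReal) : Prop :=
  ∀ (σ : Equiv.Perm (Fin n)) (x : EuclideanSpace ℝ (Fin n)),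
    f (WithLp.toLp 2 fun i => x (σ i)) = f x

/-! Write X = U Diag(x) Uᵀ and V = U Diag(v) Uᵀ with one orthogonal U. On the slice y ↦ U Diag(y)
Uᵀ, which is isometric, f ∘ λ restricts to f by symmetry, so Fréchet and proximal inequalities for V
at X descend to v at x.

The converse rests on Fan's inequality ⟨X, Y⟩ ≤ ⟨λ(X), λ(Y)⟩. For small δ > 0 one permutation sorts
both x and x + δv. Let y be λ(Y) carried back by it; Fan's inequality at X and at X + δV yields ‖y -
x‖ ≤ ‖Y - X‖ and ⟨V, Y - X⟩ ≤ ⟨v, y - x⟩ + ‖Y - X‖² / (2δ) (`exists_perm_quadratic_bound`). As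
f(λ(Y)) = f(y), the subgradient inequality for v lifts with a quadratic error only, harmless in both
definitions.

Every Fréchet subgradient V at X does have this shape: f ∘ λ is constant on the orbit of X under
orthogonal conjugation, and testing V against the orbit curve generated by VX - XV forces that
commutator to vanish. Then X and V are simultaneously diagonalizable.

The limiting and horizon formulas follow by passing to limits, using continuity of λ and compactness
of the orthogonal group. -/

variable {n : ℕ}

/-! ### Conjugated diagonal matrices and permutations -/

/-- The symmetric matrix `U (Diag a) Uᵀ`. -/
def conjDiag (U : Matrix (Fin n) (Fin n) ℝ) (a : EuclideanSpace ℝ (Fin n)) : SymMat n :=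
  ⟨U * Matrix.diagonal (fun i => a i) * U.transpose, by
    change Matrix.transpose _ = _
    simp [Matrix.mul_assoc]⟩

/-- The vector with entries permuted by `σ`. -/
noncomputable def permVec (σ : Equiv.Perm (Fin n)) (a : EuclideanSpace ℝ (Fin n)) :
    EuclideanSpace ℝ (Fin n) :=
  WithLp.toLp 2 fun i => a (σ i)

theorem orthogonal_mul_transpose {U : Matrix (Fin n) (Fin n) ℝ}
    (hU : U ∈ Matrix.orthogonalGroup (Fin n) ℝ) : U * U.transpose = 1 :=
  Matrix.mem_orthogonalGroup_iff _ _ |>.1 hU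

theorem orthogonal_transpose_mul {U : Matrix (Fin n) (Fin n) ℝ}
    (hU : U ∈ Matrix.orthogonalGroup (Fin n) ℝ) : U.transpose * U = 1 :=
  Matrix.mem_orthogonalGroup_iff' _ _ |>.1 hU

theorem euclidean_inner_eq_sum (a b : EuclideanSpace ℝ (Fin n)) :
    inner ℝ a b = ∑ i, a i * b i := by
  simp [PiLp.inner_apply, mul_comm]

theorem symMat_inner_eq_trace (X Y : SymMat n) : inner ℝ X Y = Matrix.trace (X.1 * Y.1) := rfl

theorem symMat_inner_smul_left (X Y : SymMat n) (c : ℝ) :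
    inner ℝ (c • X) Y = c * inner ℝ X Y := by
  simp only [symMat_inner_eq_trace]
  change Matrix.trace ((c • X.1) * Y.1) = _
  rw [Matrix.smul_mul, Matrix.trace_smul, smul_eq_mul]

theorem inner_permVec_permVec (σ : Equiv.Perm (Fin n)) (a b : EuclideanSpace ℝ (Fin n)) :
    inner ℝ (permVec σ a) (permVec σ b) = inner ℝ a b := by
  simp only [euclidean_inner_eq_sum, permVec]
  exact Equiv.sum_comp σ (fun i => a i * b i)

theorem norm_permVec (σ : Equiv.Perm (Fin n)) (a : EuclideanSpace ℝ (Fin n)) :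
    ‖permVec σ a‖ = ‖a‖ := by
  rw [norm_eq_sqrt_real_inner, norm_eq_sqrt_real_inner, inner_permVec_permVec]

theorem permVec_symm_permVec (σ : Equiv.Perm (Fin n)) (a : EuclideanSpace ℝ (Fin n)) :
    permVec σ (permVec σ.symm a) = a := by
  ext i; simp [permVec]

theorem conjDiag_add (U : Matrix (Fin n) (Fin n) ℝ) (a b : EuclideanSpace ℝ (Fin n)) :
    conjDiag U (a + b) = conjDiag U a + conjDiag U b := by
  apply Subtype.ext
  change U * Matrix.diagonal (fun i => a i + b i) * U.transpose = U * _ * _ + U * _ * _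
  rw [← Matrix.diagonal_add, Matrix.mul_add, Matrix.add_mul]

theorem conjDiag_smul (U : Matrix (Fin n) (Fin n) ℝ) (c : ℝ) (a : EuclideanSpace ℝ (Fin n)) :
    conjDiag U (c • a) = c • conjDiag U a := by
  apply Subtype.ext
  change U * Matrix.diagonal (c • fun i => a i) * U.transpose = c • (U * _ * _)
  rw [Matrix.diagonal_smul, Matrix.mul_smul, Matrix.smul_mul]

theorem conjDiag_sub (U : Matrix (Fin n) (Fin n) ℝ) (a b : EuclideanSpace ℝ (Fin n)) :
    conjDiag U (a - b) = conjDiag U a - conjDiag U b := by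
  have := conjDiag_add U (a - b) b
  rw [sub_add_cancel] at this
  rw [this, add_sub_cancel_right]

/-- For orthogonal U and W the squared entries on the right form a doubly stochastic matrix, the
form needed for Fan's inequality. -/
theorem inner_conjDiag_conjDiag (U W : Matrix (Fin n) (Fin n) ℝ)
    (a b : EuclideanSpace ℝ (Fin n)) :
    inner ℝ (conjDiag U a) (conjDiag W b)
      = ∑ i, ∑ j, a i * b j * ((U.transpose * W) i j) ^ 2 := by
  have h : Matrix.trace (U * Matrix.diagonal (fun i => a i) * U.transpose *
      (W * Matrix.diagonal (fun i => b i) * W.transpose))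
      = Matrix.trace ((Matrix.diagonal (fun i => a i) * (U.transpose * W)) *
        (Matrix.diagonal (fun i => b i) * (U.transpose * W).transpose)) := by
    simp only [Matrix.mul_assoc, Matrix.transpose_mul, Matrix.transpose_transpose]
    rw [Matrix.trace_mul_comm]
    simp only [Matrix.mul_assoc]
  rw [symMat_inner_eq_trace]
  refine h.trans ?_
  rw [Matrix.trace]
  refine Finset.sum_congr rfl fun i _ => ?_
  rw [Matrix.diag_apply, Matrix.mul_apply]
  refine Finset.sum_congr rfl fun j _ => ?_
  rw [Matrix.diagonal_mul, Matrix.diagonal_mul, Matrix.transpose_apply]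
  ring

theorem inner_conjDiag_same {U : Matrix (Fin n) (Fin n) ℝ}
    (hU : U ∈ Matrix.orthogonalGroup (Fin n) ℝ) (a b : EuclideanSpace ℝ (Fin n)) :
    inner ℝ (conjDiag U a) (conjDiag U b) = inner ℝ a b := by
  rw [inner_conjDiag_conjDiag, orthogonal_transpose_mul hU, euclidean_inner_eq_sum]
  refine Finset.sum_congr rfl fun i _ => ?_
  simp [Matrix.one_apply]

theorem norm_conjDiag {U : Matrix (Fin n) (Fin n) ℝ}
    (hU : U ∈ Matrix.orthogonalGroup (Fin n) ℝ) (a : EuclideanSpace ℝ (Fin n)) :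
    ‖conjDiag U a‖ = ‖a‖ := by
  have h := norm_eq_sqrt_real_inner (conjDiag U a)
  rw [inner_conjDiag_same hU] at h
  rw [h, norm_eq_sqrt_real_inner]

theorem submatrix_perm_mem_orthogonalGroup {U : Matrix (Fin n) (Fin n) ℝ}
    (hU : U ∈ Matrix.orthogonalGroup (Fin n) ℝ) (σ : Equiv.Perm (Fin n)) :
    U.submatrix id σ ∈ Matrix.orthogonalGroup (Fin n) ℝ := by
  rw [Matrix.mem_orthogonalGroup_iff]
  change U.submatrix id σ * (U.submatrix id σ).transpose = 1
  rw [Matrix.transpose_submatrix, Matrix.submatrix_mul_equiv, orthogonal_mul_transpose hU]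
  simp

/-- Permuting the columns of U along with the entries only reorders a sum of rank-one terms. This
reduces unsorted diagonals to sorted ones. -/
theorem conjDiag_submatrix_permVec (U : Matrix (Fin n) (Fin n) ℝ) (σ : Equiv.Perm (Fin n))
    (a : EuclideanSpace ℝ (Fin n)) :
    conjDiag (U.submatrix id σ) (permVec σ a) = conjDiag U a := by
  apply Subtype.ext
  ext i j
  change (_ * _ : Matrix _ _ ℝ) i j = (_ * _ : Matrix _ _ ℝ) i j
  rw [Matrix.mul_apply, Matrix.mul_apply]
  simp only [permVec, Matrix.mul_diagonal, Matrix.submatrix_apply, Matrix.transpose_apply, id]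
  exact Equiv.sum_comp σ (fun k => U i k * a k * U j k)

/-! ### Ordered spectral decomposition -/

theorem antitone_eigenvalueMap (X : SymMat n) : Antitone fun i => eigenvalueMap X i := by
  intro i j hij
  exact (SymMat.isHermitian X).eigenvalues₀_antitone (by simpa using hij)

theorem roots_charpoly_conjDiag {U : Matrix (Fin n) (Fin n) ℝ}
    (hU : U ∈ Matrix.orthogonalGroup (Fin n) ℝ) (a : EuclideanSpace ℝ (Fin n)) :
    (conjDiag U a).1.charpoly.roots = Multiset.map (fun i => a i) Finset.univ.val := by
  have h : (conjDiag U a).1.charpoly = ∏ i, (Polynomial.X - Polynomial.C (a i)) := by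
    change (U * _ * _).charpoly = _
    rw [Matrix.charpoly_mul_comm, ← Matrix.mul_assoc, orthogonal_transpose_mul hU, Matrix.one_mul,
      Matrix.charpoly_diagonal]
  rw [h, Polynomial.roots_prod _ _
    (Finset.prod_ne_zero_iff.2 fun i _ => Polynomial.X_sub_C_ne_zero _)]
  simp

theorem roots_charpoly_eq_eigenvalueMap (X : SymMat n) :
    X.1.charpoly.roots = Multiset.map (fun i => eigenvalueMap X i) Finset.univ.val := by
  rw [(SymMat.isHermitian X).roots_charpoly_eq_eigenvalues₀]
  have := Finset.map_univ_equiv (finCongr (Fintype.card_fin n).symm)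
  rw [← this, Finset.map_val, Multiset.map_map]
  rfl

/-- The characteristic polynomial determines eigenvalues only as a multiset; the ordering makes the
vector unique. -/
theorem eq_of_antitone_of_map_univ_eq {a b : Fin n → ℝ} (ha : Antitone a) (hb : Antitone b)
    (h : Multiset.map a Finset.univ.val = Multiset.map b Finset.univ.val) : a = b := by
  rw [Fin.univ_val_map, Fin.univ_val_map, Multiset.coe_eq_coe] at h
  exact List.ofFn_injective (h.eq_of_pairwise' (List.sortedGE_iff_pairwise.1 ha.sortedGE_ofFn)
    (List.sortedGE_iff_pairwise.1 hb.sortedGE_ofFn))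

theorem eigenvalueMap_conjDiag {U : Matrix (Fin n) (Fin n) ℝ}
    (hU : U ∈ Matrix.orthogonalGroup (Fin n) ℝ) {a : EuclideanSpace ℝ (Fin n)}
    (ha : Antitone fun i => a i) : eigenvalueMap (conjDiag U a) = a := by
  have := eq_of_antitone_of_map_univ_eq (antitone_eigenvalueMap (conjDiag U a)) ha
    ((roots_charpoly_eq_eigenvalueMap _).symm.trans (roots_charpoly_conjDiag hU a))
  ext i
  exact congrFun this i

theorem eigenvalueMap_conjDiag_of_antitone_permVec {U : Matrix (Fin n) (Fin n) ℝ}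
    (hU : U ∈ Matrix.orthogonalGroup (Fin n) ℝ) {a : EuclideanSpace ℝ (Fin n)}
    {σ : Equiv.Perm (Fin n)} (ha : Antitone fun i => a (σ i)) :
    eigenvalueMap (conjDiag U a) = permVec σ a := by
  rw [← conjDiag_submatrix_permVec U σ a]
  exact eigenvalueMap_conjDiag (submatrix_perm_mem_orthogonalGroup hU σ) ha

theorem exists_antitone_perm (a : Fin n → ℝ) : ∃ σ : Equiv.Perm (Fin n), Antitone fun i => a (σ i) :=
  ⟨Tuple.sort fun i => -a i, fun _ _ h => neg_le_neg_iff.1 (Tuple.monotone_sort (fun i => -a i) h)⟩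

theorem exists_conjDiag_eq (X : SymMat n) : ∃ U ∈ Matrix.orthogonalGroup (Fin n) ℝ,
    conjDiag U (eigenvalueMap X) = X := by
  have hX := SymMat.isHermitian X
  let U : Matrix (Fin n) (Fin n) ℝ := hX.eigenvectorUnitary
  have hU : U ∈ Matrix.orthogonalGroup (Fin n) ℝ := hX.eigenvectorUnitary.2
  have h : conjDiag U (WithLp.toLp 2 hX.eigenvalues) = X := by
    apply Subtype.ext
    have := hX.spectral_theorem
    rw [Unitary.conjStarAlgAut_apply] at this
    exact this.symm
  obtain ⟨σ, hσ⟩ := exists_antitone_perm hX.eigenvalues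
  refine ⟨U.submatrix id σ, submatrix_perm_mem_orthogonalGroup hU σ, ?_⟩
  have h2 := eigenvalueMap_conjDiag_of_antitone_permVec hU (a := WithLp.toLp 2 hX.eigenvalues) hσ
  rw [h] at h2
  rw [h2, conjDiag_submatrix_permVec, h]

theorem mem_diagonalizers_iff {X : SymMat n} {U : Matrix (Fin n) (Fin n) ℝ} :
    U ∈ diagonalizers X ↔
      U ∈ Matrix.orthogonalGroup (Fin n) ℝ ∧ conjDiag U (eigenvalueMap X) = X :=
  and_congr_right fun _ =>
    (Subtype.ext_iff (a1 := conjDiag U (eigenvalueMap X)) (a2 := X)).symm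

theorem mem_spectralLift_iff {X V : SymMat n} {S : Set (EuclideanSpace ℝ (Fin n))} :
    V ∈ spectralLift X S ↔ ∃ v ∈ S, ∃ U ∈ diagonalizers X, conjDiag U v = V := by
  simp only [spectralLift, Set.mem_ofPred_eq, Subtype.ext_iff, eq_comm (b := V.1)]
  rfl

theorem norm_eigenvalueMap (X : SymMat n) : ‖eigenvalueMap X‖ = ‖X‖ := by
  obtain ⟨U, hU, h⟩ := exists_conjDiag_eq X
  rw [← norm_conjDiag hU, h]

/-! ### Fan's inequality and the Lipschitz property of the eigenvalue map -/

/-- The bilinear form of a doubly stochastic matrix is bounded by the inner product at similarly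
ordered vectors. -/
theorem doublyStochastic_sum_le {a b : Fin n → ℝ} (hab : Monovary a b)
    {M : Matrix (Fin n) (Fin n) ℝ} (hM : M ∈ doublyStochastic ℝ (Fin n)) :
    ∑ i, ∑ j, a i * b j * M i j ≤ ∑ i, a i * b i := by
  -- Birkhoff's theorem reduces the bound to permutation matrices, where it is the rearrangement
  -- inequality.
  obtain ⟨w, hw0, hw1, rfl⟩ := exists_eq_sum_perm_of_mem_doublyStochastic hM
  have h : ∀ σ : Equiv.Perm (Fin n),
      ∑ i, ∑ j, a i * b j * (σ.permMatrix ℝ) i j = ∑ i, a i * b (σ i) := by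
    intro σ
    refine Finset.sum_congr rfl fun i _ => ?_
    simp [Equiv.Perm.permMatrix, PEquiv.toMatrix_apply, Equiv.toPEquiv_apply]
  calc ∑ i, ∑ j, a i * b j * (∑ σ, w σ • Equiv.Perm.permMatrix ℝ σ) i j
      = ∑ σ : Equiv.Perm (Fin n), w σ * ∑ i, ∑ j, a i * b j * (σ.permMatrix ℝ) i j := by
        simp only [Matrix.sum_apply, Matrix.smul_apply, smul_eq_mul, Finset.mul_sum]
        rw [Finset.sum_comm (s := (Finset.univ : Finset (Equiv.Perm (Fin n))))]
        refine Finset.sum_congr rfl fun i _ => ?_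
        rw [Finset.sum_comm (s := (Finset.univ : Finset (Equiv.Perm (Fin n))))]
        exact Finset.sum_congr rfl fun j _ => Finset.sum_congr rfl fun σ _ => by ring
    _ ≤ ∑ σ : Equiv.Perm (Fin n), w σ * ∑ i, a i * b i := by
        refine Finset.sum_le_sum fun σ _ => mul_le_mul_of_nonneg_left ?_ (hw0 σ)
        rw [h]
        exact hab.sum_mul_comp_perm_le_sum_mul
    _ = ∑ i, a i * b i := by rw [← Finset.sum_mul, hw1, one_mul]

theorem sq_orthogonal_mem_doublyStochastic {Q : Matrix (Fin n) (Fin n) ℝ}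
    (hQ : Q ∈ Matrix.orthogonalGroup (Fin n) ℝ) :
    (Matrix.of fun i j => Q i j ^ 2) ∈ doublyStochastic ℝ (Fin n) := by
  rw [mem_doublyStochastic_iff_sum]
  refine ⟨fun i j => sq_nonneg _, fun i => ?_, fun j => ?_⟩
  · have := congrFun (congrFun (orthogonal_mul_transpose hQ) i) i
    simpa [Matrix.mul_apply, sq] using this
  · have := congrFun (congrFun (orthogonal_transpose_mul hQ) j) j
    simpa [Matrix.mul_apply, sq] using this

/-- Fan's trace inequality. -/
theorem inner_le_inner_eigenvalueMap (X Y : SymMat n) :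
    inner ℝ X Y ≤ inner ℝ (eigenvalueMap X) (eigenvalueMap Y) := by
  obtain ⟨U, hU, hX⟩ := exists_conjDiag_eq X
  obtain ⟨W, hW, hY⟩ := exists_conjDiag_eq Y
  have hQ : U.transpose * W ∈ Matrix.orthogonalGroup (Fin n) ℝ :=
    mul_mem (Unitary.star_mem hU) hW
  calc inner ℝ X Y = inner ℝ (conjDiag U (eigenvalueMap X)) (conjDiag W (eigenvalueMap Y)) := by
        rw [hX, hY]
    _ ≤ _ := by
        rw [inner_conjDiag_conjDiag, euclidean_inner_eq_sum]
        exact doublyStochastic_sum_le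
          ((antitone_eigenvalueMap X).monovary (antitone_eigenvalueMap Y))
          (sq_orthogonal_mem_doublyStochastic hQ)

/-- Once the squares are expanded the norms cancel, and Fan's inequality remains. -/
theorem norm_eigenvalueMap_sub_le (X Y : SymMat n) :
    ‖eigenvalueMap X - eigenvalueMap Y‖ ≤ ‖X - Y‖ := by
  rw [← sq_le_sq₀ (norm_nonneg _) (norm_nonneg _), @norm_sub_sq_real, @norm_sub_sq_real,
    norm_eigenvalueMap, norm_eigenvalueMap]
  linarith [inner_le_inner_eigenvalueMap X Y]

theorem continuous_eigenvalueMap : Continuous (eigenvalueMap (n := n)) :=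
  LipschitzWith.continuous (K := 1) (LipschitzWith.of_dist_le_mul fun X Y => by
    rw [dist_eq_norm, dist_eq_norm, NNReal.coe_one, one_mul]
    exact norm_eigenvalueMap_sub_le X Y)

/-! ### Quadratic comparison of λ with a diagonal slice -/

/-- For small perturbations, one permutation sorts both `a` and `a + δ b`. -/
theorem exists_perm_antitone_add_smul (a b : Fin n → ℝ) :
    ∃ δ : ℝ, 0 < δ ∧ ∃ σ : Equiv.Perm (Fin n), (Antitone fun i => a (σ i)) ∧
      Antitone fun i => a (σ i) + δ * b (σ i) := by
  -- The finitely many strict inequalities among the `a i` survive a small perturbation, so an order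
  -- sorting `a + δ b` also sorts `a`; `b` merely breaks ties.
  have h : ∀ᶠ δ : ℝ in 𝓝[>] 0, ∀ i j, a i < a j → a i + δ * b i < a j + δ * b j := by
    refine Filter.eventually_all.2 fun i => Filter.eventually_all.2 fun j => ?_
    by_cases hij : a i < a j
    · have hc : ∀ k, Tendsto (fun δ : ℝ => a k + δ * b k) (𝓝[>] 0) (𝓝 (a k)) := fun k => by
        have : Continuous fun δ : ℝ => a k + δ * b k := by fun_prop
        simpa using (this.tendsto 0).mono_left nhdsWithin_le_nhds
      filter_upwards [(hc i).eventually_lt (hc j) hij] with δ hδ _ using hδ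
    · exact Eventually.of_forall fun δ h => absurd h hij
  obtain ⟨δ, hδ, hpos⟩ := (h.and self_mem_nhdsWithin).exists
  obtain ⟨σ, hσ⟩ := exists_antitone_perm fun i => a i + δ * b i
  refine ⟨δ, hpos, σ, fun i j hij => ?_, hσ⟩
  by_contra! hlt
  exact absurd (hσ hij) (not_le.2 (hδ _ _ hlt))

/-- Comparison of a spectral function near `U (Diag x) Uᵀ` with its generator near `x`. -/
theorem exists_perm_quadratic_bound {U : Matrix (Fin n) (Fin n) ℝ}
    (hU : U ∈ Matrix.orthogonalGroup (Fin n) ℝ) (x v : EuclideanSpace ℝ (Fin n)) :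
    ∃ K : ℝ, 0 < K ∧ ∃ σ : Equiv.Perm (Fin n),
      ∀ Y : SymMat n, ‖permVec σ.symm (eigenvalueMap Y) - x‖ ≤ ‖Y - conjDiag U x‖ ∧
        inner ℝ (conjDiag U v) (Y - conjDiag U x)
          ≤ inner ℝ v (permVec σ.symm (eigenvalueMap Y) - x) + K * ‖Y - conjDiag U x‖ ^ 2 := by
  obtain ⟨δ, hδ, σ, hx, hxv⟩ := exists_perm_antitone_add_smul (fun i => x i) (fun i => v i)
  have hX := eigenvalueMap_conjDiag_of_antitone_permVec hU hx
  have hXV : eigenvalueMap (conjDiag U (x + δ • v)) = permVec σ (x + δ • v) :=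
    eigenvalueMap_conjDiag_of_antitone_permVec hU (by simpa using hxv)
  -- Fan's inequality at x + δv bounds δ(⟨V, Y⟩ - ⟨v, y⟩) by ⟨x, y⟩ - ⟨X, Y⟩ = (‖Y - X‖² - ‖y - x‖²)
  -- / 2; dropping ‖y - x‖² and dividing by δ gives this constant.
  refine ⟨1 / (2 * δ), by positivity, σ, fun Y => ?_⟩
  set y := permVec σ.symm (eigenvalueMap Y) with hy
  have hyY : eigenvalueMap Y = permVec σ y := (permVec_symm_permVec σ _).symm
  have hn : ‖y‖ = ‖Y‖ := by rw [hy, norm_permVec, norm_eigenvalueMap]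
  have h1 : inner ℝ (conjDiag U x) Y ≤ inner ℝ x y := by
    have := inner_le_inner_eigenvalueMap (conjDiag U x) Y
    rwa [hX, hyY, inner_permVec_permVec] at this
  have h2 : inner ℝ (conjDiag U x) Y + δ * inner ℝ (conjDiag U v) Y
      ≤ inner ℝ x y + δ * inner ℝ v y := by
    have := inner_le_inner_eigenvalueMap (conjDiag U (x + δ • v)) Y
    rwa [hXV, hyY, inner_permVec_permVec, conjDiag_add, conjDiag_smul, inner_add_left,
      inner_add_left, real_inner_smul_left v,
      symMat_inner_smul_left] at this
  have e1 : ‖y - x‖ ^ 2 = ‖Y‖ ^ 2 - 2 * inner ℝ x y + ‖x‖ ^ 2 := by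
    rw [@norm_sub_sq_real, hn, real_inner_comm]
  have e2 : ‖Y - conjDiag U x‖ ^ 2 = ‖Y‖ ^ 2 - 2 * inner ℝ (conjDiag U x) Y + ‖x‖ ^ 2 := by
    rw [@norm_sub_sq_real, norm_conjDiag hU, real_inner_comm]
  refine ⟨(sq_le_sq₀ (norm_nonneg _) (norm_nonneg _)).1 (by linarith), ?_⟩
  rw [inner_sub_right, inner_sub_right, inner_conjDiag_same hU, div_mul_eq_mul_div, one_mul,
    sub_add_eq_add_sub]
  refine sub_le_sub_right ?_ _
  rw [← sub_le_iff_le_add', le_div_iff₀ (by positivity)]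
  nlinarith [sq_nonneg ‖y - x‖]

/-! ### Orbit curves, commutation and simultaneous diagonalization -/

section Subdifferentials

variable {E : Type*} [NormedAddCommGroup E] [InnerProductSpace ℝ E]

theorem proximalSubdifferential_subset_frechetSubdifferential (g : E → EReal) (x : E) :
    proximalSubdifferential g x ⊆ frechetSubdifferential g x := by
  rintro v ⟨h1, h2, r, hr, ε, hε, h⟩
  refine ⟨h1, h2, fun η hη => ?_⟩
  filter_upwards [Metric.closedBall_mem_nhds x (lt_min hε (show 0 < 2 * η / r by positivity))]
    with y hy
  rw [mem_closedBall_iff_norm, le_min_iff] at hy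
  refine le_trans (add_le_add le_rfl (EReal.coe_le_coe ?_)) (h y (mem_closedBall_iff_norm.2 hy.1))
  have := hy.2
  rw [le_div_iff₀ hr] at this
  nlinarith [norm_nonneg (y - x)]

/-- Fréchet subgradients have nonpositive inner product with the initial velocity of any curve
along which the function is constant. -/
theorem inner_le_zero_of_mem_frechetSubdifferential {g : E → EReal} {x v D : E} {c : ℝ → E}
    (hv : v ∈ frechetSubdifferential g x) (hc : ∀ t, g (c t) = g x)
    (hD : Tendsto (fun t : ℝ => t⁻¹ • (c t - x)) (𝓝[>] 0) (𝓝 D)) : inner ℝ v D ≤ 0 := by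
  obtain ⟨h1, h2, h⟩ := hv
  have hcx : Tendsto c (𝓝[>] 0) (𝓝 x) := by
    have h0 : Tendsto (fun t : ℝ => t) (𝓝[>] 0) (𝓝 0) := nhdsWithin_le_nhds
    have := (h0.smul hD).add_const x
    rw [zero_smul, zero_add] at this
    refine this.congr' ?_
    filter_upwards [self_mem_nhdsWithin] with t (ht : 0 < t)
    rw [smul_inv_smul₀ ht.ne', sub_add_cancel]
  -- The equal finite values of `g` cancel, leaving ⟨v, c t - x⟩ ≤ ε‖c t - x‖; divide by t and let t
  -- ↓ 0.
  have key : ∀ ε : ℝ, 0 < ε → inner ℝ v D ≤ ε * ‖D‖ := by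
    intro ε hε
    refine le_of_tendsto_of_tendsto (tendsto_const_nhds.inner hD) (hD.norm.const_mul ε) ?_
    filter_upwards [hcx.eventually (h ε hε), self_mem_nhdsWithin] with t ht (htp : 0 < t)
    rw [hc, ← EReal.coe_toReal h1 h2, ← EReal.coe_add, EReal.coe_le_coe_iff] at ht
    rw [inner_smul_right, norm_smul, Real.norm_of_nonneg (inv_nonneg.2 htp.le),
      mul_left_comm]
    exact mul_le_mul_of_nonneg_left (by linarith) (inv_nonneg.2 htp.le)
  have hlim : Tendsto (fun ε : ℝ => ε * ‖D‖) (𝓝[>] 0) (𝓝 0) := by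
    have : Continuous fun ε : ℝ => ε * ‖D‖ := by fun_prop
    simpa using (this.tendsto 0).mono_left nhdsWithin_le_nhds
  exact ge_of_tendsto hlim (by filter_upwards [self_mem_nhdsWithin] with ε hε using key ε hε)

end Subdifferentials

section Curve

attribute [local instance] Matrix.frobeniusNormedRing Matrix.frobeniusNormedAlgebra

/-- The one-parameter group generated by a skew-symmetric matrix. -/
theorem exists_orthogonal_curve {n : ℕ} (A M : Matrix (Fin n) (Fin n) ℝ) (hA : A.transpose = -A) :
    ∃ Q : ℝ → Matrix (Fin n) (Fin n) ℝ, (∀ t, Q t ∈ Matrix.orthogonalGroup (Fin n) ℝ) ∧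
      Q 0 = 1 ∧ HasDerivAt (fun t => Q t * M * (Q t).transpose) (A * M - M * A) 0 := by
  -- Skewness makes the transpose of exp(tA) its inverse.
  have ht : ∀ t : ℝ, (NormedSpace.exp (t • A)).transpose = NormedSpace.exp (t • -A) := by
    intro t
    rw [← Matrix.exp_transpose, Matrix.transpose_smul, hA]
  refine ⟨fun t => NormedSpace.exp (t • A), fun t => ?_, by simp, ?_⟩
  · rw [Matrix.mem_orthogonalGroup_iff']
    change (NormedSpace.exp (t • A)).transpose * _ = 1
    rw [ht, smul_neg, Matrix.exp_neg]
    exact Matrix.nonsing_inv_mul _ ((Matrix.isUnit_iff_isUnit_det _).1 (Matrix.isUnit_exp _))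
  · have h1 := hasDerivAt_exp_smul_const (𝕂 := ℝ) A (0 : ℝ)
    have h2 := hasDerivAt_exp_smul_const (𝕂 := ℝ) (-A) (0 : ℝ)
    have := (h1.mul_const M).mul h2
    have hd : NormedSpace.exp ((0 : ℝ) • A) * A * M * NormedSpace.exp ((0 : ℝ) • -A) +
        NormedSpace.exp ((0 : ℝ) • A) * M * (NormedSpace.exp ((0 : ℝ) • -A) * -A)
          = A * M - M * A := by
      simp [sub_eq_add_neg]
    exact (this.congr_deriv hd).congr_of_eventuallyEq
      (.of_forall fun t => congrArg (NormedSpace.exp (t • A) * M * ·) (ht t))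

end Curve


/-- The eigenvalue vector is a rearrangement of `y`, which `f` does not see. -/
theorem spectral_apply_conjDiag {f : EuclideanSpace ℝ (Fin n) → EReal} (hf : IsSymmetricFun f)
    {U : Matrix (Fin n) (Fin n) ℝ} (hU : U ∈ Matrix.orthogonalGroup (Fin n) ℝ)
    (y : EuclideanSpace ℝ (Fin n)) : (f ∘ eigenvalueMap) (conjDiag U y) = f y := by
  obtain ⟨σ, hσ⟩ := exists_antitone_perm fun i => y i
  rw [Function.comp_apply, eigenvalueMap_conjDiag_of_antitone_permVec hU hσ]
  exact hf σ y

theorem norm_conjDiag_sub {U : Matrix (Fin n) (Fin n) ℝ}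
    (hU : U ∈ Matrix.orthogonalGroup (Fin n) ℝ) (x y : EuclideanSpace ℝ (Fin n)) :
    ‖conjDiag U y - conjDiag U x‖ = ‖y - x‖ := by
  rw [← conjDiag_sub, norm_conjDiag hU]

theorem inner_conjDiag_sub {U : Matrix (Fin n) (Fin n) ℝ}
    (hU : U ∈ Matrix.orthogonalGroup (Fin n) ℝ) (v x y : EuclideanSpace ℝ (Fin n)) :
    inner ℝ (conjDiag U v) (conjDiag U y - conjDiag U x) = inner ℝ v (y - x) := by
  rw [← conjDiag_sub, inner_conjDiag_same hU]

theorem continuous_conjDiag_uncurry :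
    Continuous fun p : Matrix (Fin n) (Fin n) ℝ × EuclideanSpace ℝ (Fin n) =>
      conjDiag p.1 p.2 := by
  refine Continuous.subtype_mk ?_ _
  refine (continuous_fst.matrix_mul (Continuous.matrix_diagonal ?_)).matrix_mul
    continuous_fst.matrix_transpose
  exact (PiLp.continuous_ofLp 2 _).comp continuous_snd

theorem continuous_conjDiag (U : Matrix (Fin n) (Fin n) ℝ) : Continuous (conjDiag U) :=
  continuous_conjDiag_uncurry.comp (Continuous.prodMk_right U)

/-- Commuting symmetric matrices are simultaneously diagonalizable, with the eigenvalues of the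
first in nonincreasing order. -/
theorem exists_diagonalizer_of_commute {X V : SymMat n} (h : X.1 * V.1 = V.1 * X.1) :
    ∃ U ∈ diagonalizers X, ∃ v, conjDiag U v = V := by
  classical
  set A := Matrix.toEuclideanLin X.1 with hAdef
  set B := Matrix.toEuclideanLin V.1 with hBdef
  have hA : A.IsSymmetric := Matrix.isSymmetric_toEuclideanLin_iff.2 (SymMat.isHermitian X)
  have hB : B.IsSymmetric := Matrix.isSymmetric_toEuclideanLin_iff.2 (SymMat.isHermitian V)
  have hAB : Commute A B := by
    refine LinearMap.ext fun x => ?_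
    change A (B x) = B (A x)
    simp [hAdef, hBdef, Matrix.toLpLin_apply, Matrix.mulVec_mulVec, h]
  have hI := LinearMap.IsSymmetric.directSum_isInternal_of_commute hA hB hAB
  have hO := LinearMap.IsSymmetric.orthogonalFamily_eigenspace_inf_eigenspace hA hB
  -- The joint eigenspaces are indexed by all of ℝ × ℝ; a subordinate basis needs the finite family
  -- of nonzero ones.
  have hfin := WellFoundedGT.finite_ne_bot_of_iSupIndep hI.submodule_iSupIndep
  have : Fintype {i : ℝ × ℝ // Module.End.eigenspace A i.2 ⊓ Module.End.eigenspace B i.1 ≠ ⊥} :=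
    hfin.fintype
  have hI' := DirectSum.isInternal_ne_bot_iff.2 hI
  have hO' := hO.comp (f := fun i : {i : ℝ × ℝ //
    Module.End.eigenspace A i.2 ⊓ Module.End.eigenspace B i.1 ≠ ⊥} => i.1) Subtype.val_injective
  have hn : Module.finrank ℝ (EuclideanSpace ℝ (Fin n)) = n := by simp
  obtain ⟨b, hb⟩ : ∃ b : OrthonormalBasis (Fin n) ℝ (EuclideanSpace ℝ (Fin n)),
      ∀ k, ∃ c d : ℝ, A (b k) = c • b k ∧ B (b k) = d • b k :=
    ⟨hI'.subordinateOrthonormalBasis hn hO', fun k => by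
      have := hI'.subordinateOrthonormalBasis_subordinate hn k hO'
      exact ⟨_, _, Module.End.mem_eigenspace_iff.1 this.1, Module.End.mem_eigenspace_iff.1 this.2⟩⟩
  choose c d hc hd using hb
  let W : Matrix (Fin n) (Fin n) ℝ := Matrix.of fun i j => b j i
  have hW : W ∈ Matrix.orthogonalGroup (Fin n) ℝ := by
    rw [Matrix.mem_orthogonalGroup_iff']
    ext i j
    have := orthonormal_iff_ite.1 b.orthonormal i j
    rw [euclidean_inner_eq_sum] at this
    rw [Matrix.one_apply, ← this, Matrix.mul_apply]
    rfl
  have hdiag : ∀ (M : SymMat n) (e : Fin n → ℝ),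
      (∀ k, Matrix.toEuclideanLin M.1 (b k) = e k • b k) → conjDiag W (WithLp.toLp 2 e) = M := by
    intro M e he
    have h1 : M.1 * W = W * Matrix.diagonal e := by
      ext i k
      have := congrArg (fun z : EuclideanSpace ℝ (Fin n) => z i) (he k)
      rw [Matrix.mul_diagonal, Matrix.mul_apply]
      simpa [Matrix.toLpLin_apply, Matrix.mulVec, dotProduct, W, mul_comm] using this
    apply Subtype.ext
    change W * Matrix.diagonal e * W.transpose = M.1
    rw [← h1, Matrix.mul_assoc, orthogonal_mul_transpose hW, Matrix.mul_one]
  have hXW := hdiag X c hc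
  -- Only the eigenvalues of `X` are sorted; those of `V` follow the same permutation and need not
  -- be monotone.
  obtain ⟨σ, hσ⟩ := exists_antitone_perm c
  refine ⟨W.submatrix id σ, mem_diagonalizers_iff.2
    ⟨submatrix_perm_mem_orthogonalGroup hW σ, ?_⟩, permVec σ (WithLp.toLp 2 d), ?_⟩
  · have h2 := eigenvalueMap_conjDiag_of_antitone_permVec hW (a := WithLp.toLp 2 c) hσ
    rw [hXW] at h2
    rw [h2, conjDiag_submatrix_permVec, hXW]
  · rw [conjDiag_submatrix_permVec, hdiag V d hd]

/-- A Fréchet subgradient of a spectral function commutes with its base point. -/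
theorem commute_of_mem_frechetSubdifferential {f : EuclideanSpace ℝ (Fin n) → EReal}
    (hf : IsSymmetricFun f) {X V : SymMat n}
    (hV : V ∈ frechetSubdifferential (f ∘ eigenvalueMap) X) : X.1 * V.1 = V.1 * X.1 := by
  have hXt : X.1.transpose = X.1 := X.2
  have hVt : V.1.transpose = V.1 := V.2
  -- With this generator the orbit velocity D = BX - XB satisfies ⟨V, D⟩ = tr(BBᵀ) by cyclicity of
  -- the trace, so ⟨V, D⟩ ≤ 0 forces B = 0.
  set B := V.1 * X.1 - X.1 * V.1 with hB
  have hBt : B.transpose = -B := by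
    simp [hB, Matrix.transpose_sub, Matrix.transpose_mul, hXt, hVt]
  obtain ⟨Q, hQ, hQ0, hQd⟩ := exists_orthogonal_curve B X.1 hBt
  let c : ℝ → SymMat n := fun t => ⟨Q t * X.1 * (Q t).transpose, by
    change Matrix.transpose _ = _
    simp [Matrix.mul_assoc, hXt]⟩
  let D : SymMat n := ⟨B * X.1 - X.1 * B, by
    change Matrix.transpose _ = _
    simp [Matrix.transpose_sub, Matrix.transpose_mul, hXt, hBt]; abel⟩
  have hc : ∀ t, (f ∘ eigenvalueMap) (c t) = (f ∘ eigenvalueMap) X := by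
    intro t
    obtain ⟨U, hU, hX⟩ := exists_conjDiag_eq X
    have hct : c t = conjDiag (Q t * U) (eigenvalueMap X) := by
      apply Subtype.ext
      change Q t * X.1 * (Q t).transpose = _ * _ * _
      rw [← congrArg Subtype.val hX]
      change Q t * (U * _ * U.transpose) * _ = _
      simp only [Matrix.transpose_mul, Matrix.mul_assoc]
    rw [hct, spectral_apply_conjDiag hf (mul_mem (hQ t) hU), Function.comp_apply]
  have hD : Tendsto (fun t : ℝ => t⁻¹ • (c t - X)) (𝓝[>] 0) (𝓝 D) := by
    rw [tendsto_subtype_rng]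
    have := hQd.tendsto_slope_zero_right
    simp only [zero_add, hQ0, Matrix.transpose_one, Matrix.one_mul, Matrix.mul_one] at this
    exact this
  have hle := inner_le_zero_of_mem_frechetSubdifferential hV hc hD
  have htr : inner ℝ V D = Matrix.trace (B * B.transpose) := by
    change Matrix.trace (V.1 * (B * X.1 - X.1 * B)) = _
    rw [hBt, Matrix.mul_sub, Matrix.trace_sub, ← Matrix.mul_assoc, Matrix.trace_mul_comm (V.1 * B),
      ← Matrix.mul_assoc, ← Matrix.mul_assoc, ← Matrix.trace_sub, ← Matrix.sub_mul,
      show X.1 * V.1 - V.1 * X.1 = -B by rw [hB, neg_sub], Matrix.neg_mul, Matrix.mul_neg]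
  have hsum : Matrix.trace (B * B.transpose) = ∑ i, ∑ j, B i j ^ 2 := by
    simp [Matrix.trace, Matrix.mul_apply, sq]
  rw [htr, hsum] at hle
  have hB0 : B = 0 := by
    ext i j
    have h0 := le_antisymm hle (by positivity)
    have h1 := (Finset.sum_eq_zero_iff_of_nonneg fun i _ => by positivity).1 h0 i (Finset.mem_univ i)
    have h2 := (Finset.sum_eq_zero_iff_of_nonneg fun j _ => by positivity).1 h1 j (Finset.mem_univ j)
    simpa using h2
  exact (sub_eq_zero.1 hB0).symm

/-! ### Transfer of subgradients between `f` and `f ∘ eigenvalueMap` for a fixed `U` -/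

section Transfer

variable {f : EuclideanSpace ℝ (Fin n) → EReal} {U : Matrix (Fin n) (Fin n) ℝ}
  {x v : EuclideanSpace ℝ (Fin n)}

theorem apply_permVec (hf : IsSymmetricFun f) (σ : Equiv.Perm (Fin n))
    (y : EuclideanSpace ℝ (Fin n)) : f (permVec σ y) = f y := hf σ y

theorem conjDiag_mem_proximalSubdifferential_iff (hf : IsSymmetricFun f)
    (hU : U ∈ Matrix.orthogonalGroup (Fin n) ℝ) :
    conjDiag U v ∈ proximalSubdifferential (f ∘ eigenvalueMap) (conjDiag U x) ↔
      v ∈ proximalSubdifferential f x := by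
  constructor
  · rintro ⟨h1, h2, r, hr, ε, hε, h⟩
    rw [spectral_apply_conjDiag hf hU] at h1 h2
    refine ⟨h1, h2, r, hr, ε, hε, fun y hy => ?_⟩
    have := h (conjDiag U y) (by
      rw [mem_closedBall_iff_norm, norm_conjDiag_sub hU]; exact mem_closedBall_iff_norm.1 hy)
    rwa [inner_conjDiag_sub hU, norm_conjDiag_sub hU, spectral_apply_conjDiag hf hU,
      spectral_apply_conjDiag hf hU] at this
  · rintro ⟨h1, h2, r, hr, ε, hε, h⟩
    obtain ⟨K, hK, σ, hσ⟩ := exists_perm_quadratic_bound hU x v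
    have hFx := spectral_apply_conjDiag hf hU x
    -- Halving r + 2K yields r/2 from the bound for `f` plus K from the comparison; the radius is
    -- kept because ‖y - x‖ ≤ ‖Y - X‖.
    refine ⟨hFx ▸ h1, hFx ▸ h2, r + 2 * K, by positivity, ε, hε, fun Y hY => ?_⟩
    obtain ⟨hn, hi⟩ := hσ Y
    have hy := h (permVec σ.symm (eigenvalueMap Y))
      (mem_closedBall_iff_norm.2 (hn.trans (mem_closedBall_iff_norm.1 hY)))
    rw [apply_permVec hf] at hy
    rw [hFx]
    refine le_trans (add_le_add le_rfl (EReal.coe_le_coe ?_)) hy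
    nlinarith [pow_le_pow_left₀ (norm_nonneg _) hn 2]

theorem conjDiag_mem_frechetSubdifferential_iff (hf : IsSymmetricFun f)
    (hU : U ∈ Matrix.orthogonalGroup (Fin n) ℝ) :
    conjDiag U v ∈ frechetSubdifferential (f ∘ eigenvalueMap) (conjDiag U x) ↔
      v ∈ frechetSubdifferential f x := by
  constructor
  · rintro ⟨h1, h2, h⟩
    rw [spectral_apply_conjDiag hf hU] at h1 h2
    refine ⟨h1, h2, fun ε hε => ?_⟩
    filter_upwards [((continuous_conjDiag U).tendsto x).eventually (h ε hε)] with y hy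
    rwa [inner_conjDiag_sub hU, norm_conjDiag_sub hU, spectral_apply_conjDiag hf hU,
      spectral_apply_conjDiag hf hU] at hy
  · rintro ⟨h1, h2, h⟩
    obtain ⟨K, hK, σ, hσ⟩ := exists_perm_quadratic_bound hU x v
    have hFx := spectral_apply_conjDiag hf hU x
    refine ⟨hFx ▸ h1, hFx ▸ h2, fun ε hε => ?_⟩
    obtain ⟨δ, hδ, hball⟩ := Metric.eventually_nhds_iff_ball.1 (h (ε / 2) (half_pos hε))
    -- Within radius ε/(2K) the quadratic error is at most (ε/2)‖Y - X‖; the other ε/2 pays for the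
    -- Fréchet bound on `f`.
    filter_upwards [Metric.ball_mem_nhds (conjDiag U x)
      (lt_min hδ (show 0 < ε / (2 * K) by positivity))] with Y hY
    rw [mem_ball_iff_norm, lt_min_iff] at hY
    obtain ⟨hn, hi⟩ := hσ Y
    have hy := hball (permVec σ.symm (eigenvalueMap Y)) (mem_ball_iff_norm.2 (hn.trans_lt hY.1))
    rw [apply_permVec hf] at hy
    rw [hFx]
    refine le_trans (add_le_add le_rfl (EReal.coe_le_coe ?_)) hy
    have h3 := hY.2.le
    rw [le_div_iff₀ (by positivity)] at h3
    nlinarith [norm_nonneg (Y - conjDiag U x)]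

theorem conjDiag_mem_limitingSubdifferential (hf : IsSymmetricFun f)
    (hU : U ∈ Matrix.orthogonalGroup (Fin n) ℝ) (hv : v ∈ limitingSubdifferential f x) :
    conjDiag U v ∈ limitingSubdifferential (f ∘ eigenvalueMap) (conjDiag U x) := by
  obtain ⟨h1, h2, xs, vs, h, hx, hfx, hvs⟩ := hv
  have hF := spectral_apply_conjDiag hf hU
  refine ⟨hF x ▸ h1, hF x ▸ h2, fun i => conjDiag U (xs i), fun i => conjDiag U (vs i),
    fun i => (conjDiag_mem_frechetSubdifferential_iff hf hU).2 (h i),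
    ((continuous_conjDiag U).tendsto x).comp hx, ?_, ((continuous_conjDiag U).tendsto v).comp hvs⟩
  simpa only [hF] using hfx

theorem conjDiag_mem_horizonSubdifferential (hf : IsSymmetricFun f)
    (hU : U ∈ Matrix.orthogonalGroup (Fin n) ℝ) (hv : v ∈ horizonSubdifferential f x) :
    conjDiag U v ∈ horizonSubdifferential (f ∘ eigenvalueMap) (conjDiag U x) := by
  obtain ⟨h1, h2, xs, vs, t, h, hx, ht0, hta, ht, hvs⟩ := hv
  have hF := spectral_apply_conjDiag hf hU
  refine ⟨hF x ▸ h1, hF x ▸ h2, fun i => conjDiag U (xs i), fun i => conjDiag U (vs i), t,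
    fun i => conjDiag_mem_limitingSubdifferential hf hU (h i),
    ((continuous_conjDiag U).tendsto x).comp hx, ht0, hta, ht, ?_⟩
  exact (((continuous_conjDiag U).tendsto v).comp hvs).congr fun i => conjDiag_smul U _ _

theorem conjDiag_mem_attentiveHorizonSubdifferential (hf : IsSymmetricFun f)
    (hU : U ∈ Matrix.orthogonalGroup (Fin n) ℝ) (hv : v ∈ attentiveHorizonSubdifferential f x) :
    conjDiag U v ∈ attentiveHorizonSubdifferential (f ∘ eigenvalueMap) (conjDiag U x) := by
  obtain ⟨h1, h2, xs, vs, t, h, hx, hfx, ht0, hta, ht, hvs⟩ := hv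
  have hF := spectral_apply_conjDiag hf hU
  refine ⟨hF x ▸ h1, hF x ▸ h2, fun i => conjDiag U (xs i), fun i => conjDiag U (vs i), t,
    fun i => conjDiag_mem_limitingSubdifferential hf hU (h i),
    ((continuous_conjDiag U).tendsto x).comp hx, ?_, ht0, hta, ht, ?_⟩
  · simpa only [hF] using hfx
  · exact (((continuous_conjDiag U).tendsto v).comp hvs).congr fun i => conjDiag_smul U _ _

end Transfer

/-! ### Compactness and limits of diagonalizations -/

theorem isCompact_orthogonalGroup :
    IsCompact {U : Matrix (Fin n) (Fin n) ℝ | U ∈ Matrix.orthogonalGroup (Fin n) ℝ} := by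
  have hbox : IsCompact {U : Matrix (Fin n) (Fin n) ℝ | ∀ i, U i ∈ {w : Fin n → ℝ |
      ∀ j, w j ∈ Set.Icc (-1 : ℝ) 1}} :=
    isCompact_pi_infinite fun _ => isCompact_pi_infinite fun _ => isCompact_Icc
  refine hbox.of_isClosed_subset ?_ fun U hU i j => ?_
  · simp only [Matrix.mem_orthogonalGroup_iff]
    exact isClosed_eq (continuous_id.matrix_mul continuous_id.matrix_transpose) continuous_const
  · exact abs_le.1 (entry_norm_bound_of_unitary hU i j)

/-- Since `v` depends continuously on `U` and `V`, convergence of the vectors comes for free once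
the orthogonal matrices converge. -/
theorem apply_eq_of_conjDiag_eq {U : Matrix (Fin n) (Fin n) ℝ}
    (hU : U ∈ Matrix.orthogonalGroup (Fin n) ℝ) {v : EuclideanSpace ℝ (Fin n)} {V : SymMat n}
    (h : conjDiag U v = V) : v = WithLp.toLp 2 fun k => (U.transpose * V.1 * U) k k := by
  have : U.transpose * V.1 * U = Matrix.diagonal fun i => v i := by
    rw [← h]
    change U.transpose * (U * _ * U.transpose) * U = _
    rw [← Matrix.mul_assoc, ← Matrix.mul_assoc, orthogonal_transpose_mul hU, Matrix.one_mul,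
      Matrix.mul_assoc, orthogonal_transpose_mul hU, Matrix.mul_one]
  ext k
  simp [this]

/-- Simultaneous ordered diagonalizations pass to limits along a subsequence. -/
theorem exists_subseq_tendsto_diagonalizers {X V : SymMat n} {Xs Vs : ℕ → SymMat n}
    (hX : Tendsto Xs atTop (𝓝 X)) (hV : Tendsto Vs atTop (𝓝 V))
    {Us : ℕ → Matrix (Fin n) (Fin n) ℝ} {vs : ℕ → EuclideanSpace ℝ (Fin n)}
    (hU : ∀ i, Us i ∈ diagonalizers (Xs i)) (h : ∀ i, conjDiag (Us i) (vs i) = Vs i) :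
    ∃ φ : ℕ → ℕ, StrictMono φ ∧ ∃ U ∈ diagonalizers X, ∃ v, conjDiag U v = V ∧
      Tendsto (fun i => vs (φ i)) atTop (𝓝 v) := by
  simp only [mem_diagonalizers_iff] at hU ⊢
  have : FirstCountableTopology (Matrix (Fin n) (Fin n) ℝ) :=
    inferInstanceAs (FirstCountableTopology (Fin n → Fin n → ℝ))
  obtain ⟨U, hUo, φ, hφ, hlim⟩ := isCompact_orthogonalGroup.tendsto_subseq fun i => (hU i).1
  have hXφ := hX.comp hφ.tendsto_atTop
  have hVφ := hV.comp hφ.tendsto_atTop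
  have hv : Tendsto (fun i => vs (φ i)) atTop
      (𝓝 (WithLp.toLp 2 fun k => (U.transpose * V.1 * U) k k)) := by
    have hc : Continuous fun p : Matrix (Fin n) (Fin n) ℝ × SymMat n =>
        (WithLp.toLp 2 fun k => (p.1.transpose * p.2.1 * p.1) k k : EuclideanSpace ℝ (Fin n)) := by
      refine (PiLp.continuous_toLp 2 _).comp (continuous_pi fun k => ?_)
      exact Continuous.matrix_elem ((continuous_fst.matrix_transpose.matrix_mul
        (continuous_subtype_val.comp continuous_snd)).matrix_mul continuous_fst) k k
    refine ((hc.tendsto (U, V)).comp (hlim.prodMk_nhds hVφ)).congr fun i => ?_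
    exact (apply_eq_of_conjDiag_eq (hU (φ i)).1 (h (φ i))).symm
  refine ⟨φ, hφ, U, ⟨hUo, ?_⟩, _, ?_, hv⟩
  · refine tendsto_nhds_unique ((continuous_conjDiag_uncurry.tendsto
      (U, eigenvalueMap X)).comp (hlim.prodMk_nhds
        ((continuous_eigenvalueMap.tendsto X).comp hXφ))) (hXφ.congr fun i => ?_)
    exact (hU (φ i)).2.symm
  · refine tendsto_nhds_unique ((continuous_conjDiag_uncurry.tendsto (U, _)).comp
      (hlim.prodMk_nhds hv)) (hVφ.congr fun i => ?_)
    exact (h (φ i)).symm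

/-! ### The five subdifferential formulas -/

section Formulas

variable {f : EuclideanSpace ℝ (Fin n) → EReal}

theorem spectralLift_subset {S : EuclideanSpace ℝ (Fin n) → Set (EuclideanSpace ℝ (Fin n))}
    {T : SymMat n → Set (SymMat n)}
    (h : ∀ {U : Matrix (Fin n) (Fin n) ℝ} {x v : EuclideanSpace ℝ (Fin n)},
      U ∈ Matrix.orthogonalGroup (Fin n) ℝ → v ∈ S x → conjDiag U v ∈ T (conjDiag U x))
    (X : SymMat n) : spectralLift X (S (eigenvalueMap X)) ⊆ T X := by
  intro V hV
  obtain ⟨v, hv, U, hU, rfl⟩ := mem_spectralLift_iff.1 hV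
  obtain ⟨hUo, hX⟩ := mem_diagonalizers_iff.1 hU
  have := h hUo hv
  rwa [hX] at this

theorem proximalSubdifferential_spectral (hf : IsSymmetricFun f) (X : SymMat n) :
    proximalSubdifferential (f ∘ eigenvalueMap) X
      = spectralLift X (proximalSubdifferential f (eigenvalueMap X)) := by
  refine Set.Subset.antisymm (fun V hV => ?_) (spectralLift_subset
    (fun hU hv => (conjDiag_mem_proximalSubdifferential_iff hf hU).2 hv) X)
  obtain ⟨U, hU, v, rfl⟩ := exists_diagonalizer_of_commute (commute_of_mem_frechetSubdifferential hf
    (proximalSubdifferential_subset_frechetSubdifferential _ _ hV))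
  obtain ⟨hUo, hX⟩ := mem_diagonalizers_iff.1 hU
  refine mem_spectralLift_iff.2 ⟨v, (conjDiag_mem_proximalSubdifferential_iff hf hUo).1 ?_,
    U, hU, rfl⟩
  rwa [hX]

theorem frechetSubdifferential_spectral (hf : IsSymmetricFun f) (X : SymMat n) :
    frechetSubdifferential (f ∘ eigenvalueMap) X
      = spectralLift X (frechetSubdifferential f (eigenvalueMap X)) := by
  refine Set.Subset.antisymm (fun V hV => ?_) (spectralLift_subset
    (fun hU hv => (conjDiag_mem_frechetSubdifferential_iff hf hU).2 hv) X)
  obtain ⟨U, hU, v, rfl⟩ := exists_diagonalizer_of_commute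
    (commute_of_mem_frechetSubdifferential hf hV)
  obtain ⟨hUo, hX⟩ := mem_diagonalizers_iff.1 hU
  refine mem_spectralLift_iff.2 ⟨v, (conjDiag_mem_frechetSubdifferential_iff hf hUo).1 ?_,
    U, hU, rfl⟩
  rwa [hX]

theorem limitingSubdifferential_spectral (hf : IsSymmetricFun f) (X : SymMat n) :
    limitingSubdifferential (f ∘ eigenvalueMap) X
      = spectralLift X (limitingSubdifferential f (eigenvalueMap X)) := by
  refine Set.Subset.antisymm ?_ (spectralLift_subset
    (fun hU hv => conjDiag_mem_limitingSubdifferential hf hU hv) X)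
  rintro V ⟨h1, h2, Xs, Vs, h, hX, hfX, hV⟩
  simp only [frechetSubdifferential_spectral hf, mem_spectralLift_iff] at h
  choose vs hvs Us hUs hUV using h
  obtain ⟨φ, hφ, U, hU, v, rfl, hv⟩ := exists_subseq_tendsto_diagonalizers hX hV hUs hUV
  exact mem_spectralLift_iff.2 ⟨v, ⟨h1, h2, fun i => eigenvalueMap (Xs (φ i)), fun i => vs (φ i),
    fun i => hvs (φ i),
    (continuous_eigenvalueMap.tendsto X).comp (hX.comp hφ.tendsto_atTop),
    hfX.comp hφ.tendsto_atTop, hv⟩, U, hU, rfl⟩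

theorem horizonSubdifferential_spectral (hf : IsSymmetricFun f) (X : SymMat n) :
    horizonSubdifferential (f ∘ eigenvalueMap) X
      = spectralLift X (horizonSubdifferential f (eigenvalueMap X)) := by
  refine Set.Subset.antisymm ?_ (spectralLift_subset
    (fun hU hv => conjDiag_mem_horizonSubdifferential hf hU hv) X)
  rintro V ⟨h1, h2, Xs, Vs, t, h, hX, ht0, hta, ht, hV⟩
  simp only [limitingSubdifferential_spectral hf, mem_spectralLift_iff] at h
  choose vs hvs Us hUs hUV using h
  -- The limit is taken along the scaled vectors, since the `vs i` themselves may be unbounded.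
  obtain ⟨φ, hφ, U, hU, v, rfl, hv⟩ := exists_subseq_tendsto_diagonalizers hX hV hUs
    (vs := fun i => t i • vs i) (fun i => by rw [conjDiag_smul, hUV])
  exact mem_spectralLift_iff.2 ⟨v, ⟨h1, h2, fun i => eigenvalueMap (Xs (φ i)), fun i => vs (φ i),
    fun i => t (φ i), fun i => hvs (φ i),
    (continuous_eigenvalueMap.tendsto X).comp (hX.comp hφ.tendsto_atTop),
    fun i => ht0 _, hta.comp_monotone hφ.monotone, ht.comp hφ.tendsto_atTop, hv⟩, U, hU, rfl⟩

theorem attentiveHorizonSubdifferential_spectral (hf : IsSymmetricFun f) (X : SymMat n) :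
    attentiveHorizonSubdifferential (f ∘ eigenvalueMap) X
      = spectralLift X (attentiveHorizonSubdifferential f (eigenvalueMap X)) := by
  refine Set.Subset.antisymm ?_ (spectralLift_subset
    (fun hU hv => conjDiag_mem_attentiveHorizonSubdifferential hf hU hv) X)
  rintro V ⟨h1, h2, Xs, Vs, t, h, hX, hfX, ht0, hta, ht, hV⟩
  simp only [limitingSubdifferential_spectral hf, mem_spectralLift_iff] at h
  choose vs hvs Us hUs hUV using h
  obtain ⟨φ, hφ, U, hU, v, rfl, hv⟩ := exists_subseq_tendsto_diagonalizers hX hV hUs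
    (vs := fun i => t i • vs i) (fun i => by rw [conjDiag_smul, hUV])
  exact mem_spectralLift_iff.2 ⟨v, ⟨h1, h2, fun i => eigenvalueMap (Xs (φ i)), fun i => vs (φ i),
    fun i => t (φ i), fun i => hvs (φ i),
    (continuous_eigenvalueMap.tendsto X).comp (hX.comp hφ.tendsto_atTop),
    hfX.comp hφ.tendsto_atTop,
    fun i => ht0 _, hta.comp_monotone hφ.monotone, ht.comp hφ.tendsto_atTop, hv⟩, U, hU, rfl⟩

end Formulas

theorem theorem4p2 (n : ℕ) (f : EuclideanSpace ℝ (Fin n) → EReal)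
    (hlsc : LowerSemicontinuous f) (hsymm : IsSymmetricFun f) (X : SymMat n) :
    limitingSubdifferential (f ∘ eigenvalueMap) X
        = spectralLift X (limitingSubdifferential f (eigenvalueMap X)) ∧
    proximalSubdifferential (f ∘ eigenvalueMap) X
        = spectralLift X (proximalSubdifferential f (eigenvalueMap X)) ∧
    frechetSubdifferential (f ∘ eigenvalueMap) X
        = spectralLift X (frechetSubdifferential f (eigenvalueMap X)) ∧
    horizonSubdifferential (f ∘ eigenvalueMap) X
        = spectralLift X (horizonSubdifferential f (eigenvalueMap X)) ∧
    attentiveHorizonSubdifferential (f ∘ eigenvalueMap) X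
        = spectralLift X (attentiveHorizonSubdifferential f (eigenvalueMap X)) :=
  ⟨limitingSubdifferential_spectral hsymm X, proximalSubdifferential_spectral hsymm X,
    frechetSubdifferential_spectral hsymm X, horizonSubdifferential_spectral hsymm X,
    attentiveHorizonSubdifferential_spectral hsymm X⟩
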